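/- Let $\mathbb{D}=\{z\in\mathbb{C}:|z|<1\}$ and let $(F_n)_{n\ge 0}$ be any sequence of holomorphic maps $F_n:\mathbb{D}\to\mathbb{D}$ such that $$\sum_{n=0}^{\infty}\bigl(1-|F_n(0)|\bigr)<\infty.$$ Then, for almost every $\zeta\in\partial\mathbb{D}$ with respect to arc length, the radial limit $F_n(\zeta):=\lim_{r\to1^-}F_n(r\zeta)$ exists for every $n$, and $$|F_n(\zeta)-F_n(0)|\to 0\quad\text{as } n\to\infty.$$ In other words, the Denjoy--Wolff set of $(F_n)$, that is, the set of those $\zeta\in\partial\mathbb{D}$ at which all the radial limits $F_n(\zeta)$ exist and $|F_n(\zeta)-F_n(0)|\to0$, has full arc length measure in $\partial\mathbb{D}$. -/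

import Mathlib

open MeasureTheory Filter Topology

/-- The unit circle carries its Borel `σ`-algebra. -/
noncomputable instance Circle.measurableSpaceBorel : MeasurableSpace Circle := borel Circle

instance Circle.borelSpaceBorel : BorelSpace Circle := ⟨rfl⟩

/-- The arc length measure on the unit circle `∂𝔻` (total mass `2π`): the image of Lebesgue measure
on `(-π, π]` under `θ ↦ e^{iθ}`. -/
noncomputable def arcLength : Measure Circle :=
  Measure.map Circle.exp (volume.restrict (Set.Ioc (-Real.pi) Real.pi))

/-- `f` is a holomorphic self-map of the open unit disc `𝔻`. -/
def IsHolomorphicSelfMapOfDisc (f : ℂ → ℂ) : Prop :=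
  DifferentiableOn ℂ f (Metric.ball 0 1) ∧ Set.MapsTo f (Metric.ball 0 1) (Metric.ball 0 1)

/-- The radial limit `f(ζ) = lim_{r → 1⁻} f(rζ)` of `f` at the point `ζ` of the unit circle exists
and is equal to `w`. -/
def HasRadialLimit (f : ℂ → ℂ) (ζ : Circle) (w : ℂ) : Prop :=
  Tendsto (fun r : ℝ => f ((r : ℂ) * (ζ : ℂ))) (𝓝[<] (1 : ℝ)) (𝓝 w)

/-- The Denjoy-Wolff set of a sequence `F` of self-maps of `𝔻`: the points `ζ` of the unit circle at
which every `F n` has a radial limit `F n (ζ)` and `dist (F n (ζ)) (F n (0)) → 0`. -/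
def denjoyWolffSet (F : ℕ → ℂ → ℂ) : Set Circle :=
  {ζ | ∃ w : ℕ → ℂ, (∀ n, HasRadialLimit (F n) ζ (w n)) ∧
    Tendsto (fun n => dist (w n) (F n 0)) atTop (𝓝 0)}

/-! For `f : 𝔻 → 𝔻`, expand `|f - f 0|²` on a circle of radius `r < 1`, bound `|f|²` by 1 and apply
the mean value property: the integral is at most `2π(1 - |f 0|²) ≤ 4π(1 - |f 0|)`. Fatou's lemma
carries this to the boundary, and summability of `1 - |F n 0|` makes `∑ |F n ζ - F n 0|²` finite
almost everywhere. Radial limits come from a primitive `g` of `f`: it is Lipschitz, so `g(e^{iθ})`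
is differentiable for almost every `θ`. At such a point a maximum-principle argument carries the
first-order expansion of `g` into the disc, and Cauchy's estimate turns it into convergence of `g' =
f`. -/

/-! ### From boundary smallness to interior smallness -/

open Metric Asymptotics in
/-- A function holomorphic in the disc that is `o(z - 1)` on the boundary at `1` and `O(z - 1)` on
the closed disc is `o(z - 1)` in the disc. -/
theorem eventually_norm_le_of_isLittleO_sphere {h : ℂ → ℂ} {C : ℝ}
    (hd : DiffContOnCl ℂ h (ball 0 1)) (hC : ∀ z ∈ closedBall (0 : ℂ) 1, ‖h z‖ ≤ C * ‖z - 1‖)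
    (ho : h =o[𝓝[sphere 0 1] 1] fun z => z - 1) {ε : ℝ} (hε : 0 < ε) :
    ∃ δ > 0, ∀ z ∈ ball (0 : ℂ) 1, ‖z - 1‖ < δ → ‖h z‖ ≤ ε * ‖z - 1‖ := by
  obtain ⟨η, hη, hη'⟩ : ∃ η > 0, ∀ z ∈ sphere (0 : ℂ) 1, ‖z - 1‖ < η → ‖h z‖ ≤ ε / 2 * ‖z - 1‖ := by
    have h1 := ho.bound (half_pos hε)
    rw [eventually_nhdsWithin_iff, Metric.eventually_nhds_iff] at h1
    obtain ⟨η, hη, h2⟩ := h1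
    exact ⟨η, hη, fun z hz hzη => h2 (by rwa [dist_eq_norm]) hz⟩
  set q : ℝ := √(1 - η ^ 2 / 4) with hq
  have hq1 : q < 1 := by
    rw [hq, Real.sqrt_lt' one_pos]
    nlinarith [sq_pos_of_pos hη]
  obtain ⟨N, hN⟩ : ∃ N : ℕ, |C| * q ^ N ≤ ε / 2 := by
    have h1 : Tendsto (fun N : ℕ => |C| * q ^ N) atTop (𝓝 (|C| * 0)) :=
      (tendsto_pow_atTop_nhds_zero_of_lt_one (Real.sqrt_nonneg _) hq1).const_mul _
    rw [mul_zero] at h1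
    exact (h1.eventually_le_const (half_pos hε)).exists
  -- A peak function: `φ 1 = 1`, while on the part of the circle at distance at least `η` from 1,
  -- `|φ| ≤ q ^ N` absorbs the constant `C`.
  set φ : ℂ → ℂ := fun z => ((1 + z) / 2) ^ N with hφ
  have hφd : Differentiable ℂ φ := by fun_prop
  have hbd : ∀ z ∈ sphere (0 : ℂ) 1, ‖h z * φ z‖ ≤ ε / 2 * ‖z - 1‖ := by
    intro z hz
    have hz1 : ‖z‖ = 1 := by simpa using hz
    have hpar : ‖(1 + z) / 2‖ ^ 2 = 1 - ‖z - 1‖ ^ 2 / 4 := by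
      have := parallelogram_law_with_norm ℝ z 1
      rw [hz1, norm_one] at this
      rw [norm_div, add_comm, Complex.norm_ofNat]
      linarith
    rw [norm_mul, hφ]
    simp only [norm_pow]
    rcases lt_or_ge ‖z - 1‖ η with h1 | h1
    · have h2 : ‖(1 + z) / 2‖ ≤ 1 := by nlinarith [sq_nonneg ‖z - 1‖, norm_nonneg ((1 + z) / 2)]
      calc _ ≤ (ε / 2 * ‖z - 1‖) * 1 := by
            gcongr
            · exact hη' z hz h1
            · exact pow_le_one₀ (norm_nonneg _) h2
        _ = _ := mul_one _
    · have h2 : ‖(1 + z) / 2‖ ≤ q := by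
        apply Real.le_sqrt_of_sq_le
        rw [hpar]
        gcongr
      calc _ ≤ (|C| * ‖z - 1‖) * q ^ N := by
            gcongr
            exact (hC z (sphere_subset_closedBall hz)).trans (by gcongr; exact le_abs_self C)
        _ = (|C| * q ^ N) * ‖z - 1‖ := by ring
        _ ≤ _ := by gcongr
  have hin : ∀ z ∈ ball (0 : ℂ) 1, ‖h z * φ z‖ ≤ ε / 2 * ‖z - 1‖ := by
    intro z hz
    -- Dividing by `z - 1` would put a pole on the boundary. Moving it out to `1 + s` permits the
    -- maximum principle, and only increases the distance from points of the closed disc.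
    have hs : ∀ s : ℝ, 0 < s → ‖h z * φ z‖ ≤ ε / 2 * ‖z - (1 + s)‖ := by
      intro s hs
      have hne : ∀ x ∈ closedBall (0 : ℂ) 1, x - (1 + s) ≠ 0 := by
        intro x hx h0
        have h1 : x.re ≤ 1 := (Complex.re_le_norm x).trans (by simpa using hx)
        have h2 := congrArg Complex.re h0
        simp at h2
        linarith
      have hk : DiffContOnCl ℂ (fun x : ℂ => (x - (1 + (s : ℂ)))⁻¹ • (h x * φ x)) (ball 0 1) := by
        refine DiffContOnCl.smul (DiffContOnCl.inv ?_ ?_) (hd.smul hφd.diffContOnCl)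
        · exact Differentiable.diffContOnCl (by fun_prop)
        · rwa [closure_ball _ one_ne_zero]
      have hmax := Complex.norm_le_of_forall_mem_frontier_norm_le isBounded_ball hk (C := ε / 2)
        (fun x hx => ?_) (subset_closure hz)
      · rw [norm_smul, norm_inv, inv_mul_le_iff₀
          (norm_pos_iff.2 (hne z (ball_subset_closedBall hz)))] at hmax
        linarith
      · rw [frontier_ball _ one_ne_zero] at hx
        have hx' := sphere_subset_closedBall hx
        rw [norm_smul, norm_inv, inv_mul_le_iff₀ (norm_pos_iff.2 (hne x hx')), mul_comm _ (ε / 2)]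
        refine (hbd x hx).trans ?_
        gcongr
        have h1 : x.re ≤ 1 := (Complex.re_le_norm x).trans (by simpa using hx')
        rw [Complex.norm_def, Complex.norm_def]
        apply Real.sqrt_le_sqrt
        simp [Complex.normSq_apply]
        nlinarith
    have hlim : Tendsto (fun s : ℝ => ε / 2 * ‖z - (1 + s)‖) (𝓝[>] 0) (𝓝 (ε / 2 * ‖z - 1‖)) := by
      have : Continuous (fun s : ℝ => ε / 2 * ‖z - (1 + s)‖) := by fun_prop
      simpa using (this.tendsto 0).mono_left nhdsWithin_le_nhds
    exact ge_of_tendsto hlim (eventually_nhdsWithin_of_forall hs)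
  obtain ⟨δ, hδ, hδ'⟩ : ∃ δ > 0, ∀ z : ℂ, ‖z - 1‖ < δ → 1 / 2 < ‖φ z‖ := by
    have h1 : ∀ᶠ z in 𝓝 (1 : ℂ), 1 / 2 < ‖φ z‖ := by
      apply hφd.continuous.norm.continuousAt.eventually_const_lt
      simp [hφ]
      norm_num
    obtain ⟨δ, hδ, h2⟩ := Metric.eventually_nhds_iff.1 h1
    exact ⟨δ, hδ, fun z hz => h2 (by rwa [dist_eq_norm])⟩
  refine ⟨δ, hδ, fun z hz hzδ => ?_⟩
  have h1 := hin z hz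
  rw [norm_mul] at h1
  nlinarith [hδ' z hzδ, norm_nonneg (h z)]

-- Cauchy's estimate on the circle of radius `(1 - r) / 2` about `r`, where `|z - 1|` is comparable
-- to that radius.
open Metric Asymptotics in
theorem tendsto_deriv_of_isLittleO_sphere {h : ℂ → ℂ} {C : ℝ}
    (hd : DiffContOnCl ℂ h (ball 0 1)) (hC : ∀ z ∈ closedBall (0 : ℂ) 1, ‖h z‖ ≤ C * ‖z - 1‖)
    (ho : h =o[𝓝[sphere 0 1] 1] fun z => z - 1) :
    Tendsto (fun r : ℝ => deriv h r) (𝓝[<] 1) (𝓝 0) := by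
  rw [Metric.tendsto_nhds]
  intro ε hε
  obtain ⟨δ, hδ, H⟩ := eventually_norm_le_of_isLittleO_sphere hd hC ho (ε := ε / 4) (by positivity)
  have h0 : max 0 (1 - δ / 2) < (1 : ℝ) := max_lt one_pos (by linarith)
  filter_upwards [Ioo_mem_nhdsLT h0] with r hr
  obtain ⟨hr0, hrδ⟩ := max_lt_iff.1 hr.1
  have hr1 := hr.2
  have hR : 0 < (1 - r) / 2 := by linarith
  have hsub : closedBall (r : ℂ) ((1 - r) / 2) ⊆ ball 0 1 := by
    apply closedBall_subset_ball'
    rw [dist_zero_right, Complex.norm_of_nonneg hr0.le]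
    linarith
  have hcau := Complex.norm_deriv_le_of_forall_mem_sphere_norm_le (f := h) (c := (r : ℂ))
    (C := ε / 4 * (3 / 2 * (1 - r))) hR ?_ ?_
  · rw [dist_zero_right]
    refine hcau.trans_lt ?_
    rw [div_lt_iff₀ hR]
    nlinarith
  · exact (hd.differentiableOn.mono hsub).diffContOnCl_ball subset_rfl
  · intro z hz
    have hz1 : ‖z - 1‖ ≤ 3 / 2 * (1 - r) := by
      have h1 : ‖z - r‖ = (1 - r) / 2 := by simpa [dist_eq_norm] using hz
      have h2 : ‖(r : ℂ) - 1‖ = 1 - r := by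
        rw [← Complex.ofReal_one, ← Complex.ofReal_sub, Complex.norm_real, Real.norm_eq_abs,
          abs_of_neg (by linarith)]
        ring
      have := norm_sub_le_norm_sub_add_norm_sub z r 1
      linarith
    refine (H z (hsub (sphere_subset_closedBall hz)) (by linarith)).trans ?_
    gcongr

/-! ### Fatou's theorem on radial limits -/

open Metric Asymptotics in
/-- If the boundary values of a Lipschitz primitive of `f` are differentiable at `e^{iθ}`, then `f`
has a radial limit there. -/
theorem exists_hasRadialLimit_of_differentiableAt {f g : ℂ → ℂ} {K : NNReal} {θ : ℝ}
    (hg : LipschitzWith K g) (hfg : ∀ z ∈ ball (0 : ℂ) 1, HasDerivAt g (f z) z)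
    (hθ : DifferentiableAt ℝ (fun t => g (Circle.exp t)) θ) :
    ∃ w, HasRadialLimit f (Circle.exp θ) w := by
  set ζ : ℂ := ((Circle.exp θ : Circle) : ℂ) with hζ
  have hζ1 : ‖ζ‖ = 1 := Circle.norm_coe _
  have hζ0 : ζ ≠ 0 := Circle.coe_ne_zero _
  set d := deriv (fun t => g (Circle.exp t)) θ with hdd
  -- Since `e^{it}` has derivative `i` at 0, this slope cancels the first-order term of `h` along
  -- the circle.
  set c : ℂ := d / Complex.I with hc
  set h : ℂ → ℂ := fun z => g (ζ * z) - g ζ - c * (z - 1) with hh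
  have hmem : ∀ z ∈ ball (0 : ℂ) 1, ζ * z ∈ ball (0 : ℂ) 1 := by
    intro z hz
    simpa [hζ1] using hz
  have hder : ∀ z ∈ ball (0 : ℂ) 1, HasDerivAt h (f (ζ * z) * ζ - c) z := by
    intro z hz
    have h1 : HasDerivAt (fun z => ζ * z) ζ z := by simpa using (hasDerivAt_id z).const_mul ζ
    have h2 : HasDerivAt (fun z => c * (z - 1)) c z := by
      simpa using ((hasDerivAt_id z).sub_const 1).const_mul c
    exact (((hfg _ (hmem z hz)).comp z h1).sub_const _).sub h2
  have hd : DiffContOnCl ℂ h (ball 0 1) := by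
    refine ⟨fun z hz => (hder z hz).differentiableAt.differentiableWithinAt, ?_⟩
    have := hg.continuous
    exact Continuous.continuousOn (by fun_prop)
  have hC : ∀ z ∈ closedBall (0 : ℂ) 1, ‖h z‖ ≤ (K + ‖c‖) * ‖z - 1‖ := by
    intro z _
    have h1 : ‖g (ζ * z) - g ζ‖ ≤ K * ‖z - 1‖ := by
      refine (hg.norm_sub_le _ _).trans_eq ?_
      rw [← mul_sub_one, norm_mul, hζ1, one_mul]
    calc ‖h z‖ ≤ ‖g (ζ * z) - g ζ‖ + ‖c * (z - 1)‖ := norm_sub_le _ _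
      _ ≤ K * ‖z - 1‖ + ‖c‖ * ‖z - 1‖ := by rw [norm_mul]; gcongr
      _ = _ := by ring
  have hk : (fun t : ℝ => g (Circle.exp (θ + t)) - g ζ - c * (Circle.exp t - 1)) =o[𝓝 0]
      fun t : ℝ => t := by
    have h1 : HasDerivAt (fun t : ℝ => g (Circle.exp (θ + t))) d 0 := by
      have : HasDerivAt (fun t => g (Circle.exp t)) d (θ + 0) := by
        rw [add_zero]; exact hθ.hasDerivAt
      exact this.comp_const_add θ 0
    have h2 : HasDerivAt (fun t : ℝ => ((Circle.exp t : Circle) : ℂ)) Complex.I 0 := by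
      have h3 : HasDerivAt (fun t : ℂ => Complex.exp (t * Complex.I)) Complex.I ((0 : ℝ) : ℂ) := by
        simpa using ((hasDerivAt_id ((0 : ℝ) : ℂ)).mul_const Complex.I).cexp
      simpa [Circle.coe_exp] using h3.comp_ofReal
    have h4 := (h1.sub_const (g ζ)).sub ((h2.sub_const 1).const_mul c)
    have h5 : d - c * Complex.I = 0 := by rw [hc, div_mul_cancel₀ _ Complex.I_ne_zero, sub_self]
    rw [h5, hasDerivAt_iff_isLittleO] at h4
    simpa [hζ] using h4
  have harg0 : Tendsto Complex.arg (𝓝 1) (𝓝 0) := by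
    simpa using (Complex.continuousAt_arg (x := 1) (by simp)).tendsto
  have hargO : Complex.arg =O[𝓝 1] fun z => z - 1 := by
    have h1 := (Complex.hasDerivAt_log (z := 1) (by simp)).differentiableAt.isBigO_sub
    simp only [Complex.log_one, sub_zero] at h1
    refine IsBigO.trans (IsBigO.of_bound 1 (Eventually.of_forall fun z => ?_)) h1
    rw [one_mul, ← Complex.log_im]
    exact Complex.abs_im_le_norm _
  have ho : h =o[𝓝[sphere 0 1] 1] fun z => z - 1 := by
    have h1 := ((hk.comp_tendsto harg0).trans_isBigO hargO).mono
      (nhdsWithin_le_nhds (s := sphere (0 : ℂ) 1))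
    refine h1.congr' ?_ EventuallyEq.rfl
    filter_upwards [self_mem_nhdsWithin] with z hz
    have hz1 : ‖z‖ = 1 := by simpa using hz
    have h2 : ((Circle.exp z.arg : Circle) : ℂ) = z := by
      have := Complex.norm_mul_exp_arg_mul_I z
      rwa [hz1, Complex.ofReal_one, one_mul] at this
    simp only [Function.comp, hh, Circle.exp_add, Circle.coe_mul, h2, hζ]
  have hlim := tendsto_deriv_of_isLittleO_sphere hd hC ho
  refine ⟨c / ζ, ?_⟩
  have h1 : Tendsto (fun r : ℝ => (deriv h r + c) / ζ) (𝓝[<] 1) (𝓝 ((0 + c) / ζ)) :=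
    (hlim.add_const c).div_const ζ
  rw [zero_add] at h1
  refine h1.congr' ?_
  filter_upwards [Ioo_mem_nhdsLT (zero_lt_one (α := ℝ))] with r hr
  have hr' : (r : ℂ) ∈ ball (0 : ℂ) 1 := by
    simpa [abs_of_pos hr.1] using hr.2
  rw [(hder r hr').deriv, sub_add_cancel, mul_div_cancel_right₀ _ hζ0, mul_comm]

open Metric in
/-- **Fatou's theorem** for holomorphic self-maps of the disc. -/
theorem IsHolomorphicSelfMapOfDisc.ae_exists_hasRadialLimit {f : ℂ → ℂ}
    (hf : IsHolomorphicSelfMapOfDisc f) :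
    ∀ᵐ θ : ℝ, ∃ w, HasRadialLimit f (Circle.exp θ) w := by
  obtain ⟨g₀, hg₀⟩ := hf.1.isExactOn_ball
  have hlip : LipschitzOnWith 1 g₀ (ball 0 1) := by
    refine (convex_ball (0 : ℂ) 1).lipschitzOnWith_of_nnnorm_hasDerivWithin_le
      (fun z hz => (hg₀ z hz).hasDerivWithinAt) fun z hz => ?_
    have := hf.2 hz
    rw [mem_ball_zero_iff] at this
    exact this.le
  -- The Lipschitz extension supplies the boundary values of the primitive.
  obtain ⟨g, hg, hgg⟩ := hlip.extend_finite_dimension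
  have hder : ∀ z ∈ ball (0 : ℂ) 1, HasDerivAt g (f z) z := fun z hz =>
    (hg₀ z hz).congr_of_eventuallyEq (by
      filter_upwards [isOpen_ball.mem_nhds hz] with x hx using (hgg hx).symm)
  have hexp : LipschitzWith 1 fun t : ℝ => ((Circle.exp t : Circle) : ℂ) := by
    refine lipschitzWith_of_nnnorm_deriv_le (𝕜 := ℝ) ?_ ?_
    · simp only [Circle.coe_exp]
      fun_prop
    · intro t
      have h3 : HasDerivAt (fun t : ℂ => Complex.exp (t * Complex.I))
          (Complex.exp (t * Complex.I) * Complex.I) (t : ℂ) := by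
        simpa using ((hasDerivAt_id (t : ℂ)).mul_const Complex.I).cexp
      simp only [Circle.coe_exp]
      rw [h3.comp_ofReal.deriv, ← NNReal.coe_le_coe]
      simp
  filter_upwards [(hg.comp hexp).ae_differentiableAt_real] with θ hθ
  exact exists_hasRadialLimit_of_differentiableAt hg hder hθ

/-! ### Mean-square estimate on circles -/

theorem ofReal_mul_circle_mem_ball {r : ℝ} (hr : r ∈ Set.Ioo 0 1) (ζ : Circle) :
    (r : ℂ) * ζ ∈ Metric.ball (0 : ℂ) 1 := by
  rw [mem_ball_zero_iff, norm_mul, Circle.norm_coe, mul_one, Complex.norm_of_nonneg hr.1.le]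
  exact hr.2

theorem IsHolomorphicSelfMapOfDisc.continuous_circle {f : ℂ → ℂ}
    (hf : IsHolomorphicSelfMapOfDisc f) {r : ℝ} (hr : r ∈ Set.Ioo 0 1) :
    Continuous fun θ : ℝ => f (r * Circle.exp θ) :=
  hf.1.continuousOn.comp_continuous (by fun_prop) fun θ => ofReal_mul_circle_mem_ball hr _

theorem IsHolomorphicSelfMapOfDisc.integral_circle {f : ℂ → ℂ}
    (hf : IsHolomorphicSelfMapOfDisc f) {r : ℝ} (hr : r ∈ Set.Ioo 0 1) :
    ∫ θ in -Real.pi..Real.pi, f (r * Circle.exp θ) = 2 * Real.pi * f 0 := by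
  have h1 : DiffContOnCl ℂ f (Metric.ball 0 |r|) := by
    refine hf.1.diffContOnCl_ball ?_
    rw [abs_of_pos hr.1]
    exact Metric.closedBall_subset_ball hr.2
  have h2 := h1.circleAverage
  rw [Real.circleAverage_eq_integral_add (-Real.pi)] at h2
  have h3 : ∀ θ : ℝ, circleMap 0 r θ = r * Circle.exp θ := fun θ => by
    simp [circleMap, Circle.coe_exp]
  have h4 := intervalIntegral.integral_comp_add_right (a := 0) (b := 2 * Real.pi)
    (fun θ => f (circleMap 0 r θ)) (-Real.pi)
  rw [h4, show (0 : ℝ) + -Real.pi = -Real.pi by ring,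
    show 2 * Real.pi + -Real.pi = Real.pi by ring] at h2
  simp only [h3] at h2
  rw [← h2, Complex.real_smul]
  push_cast
  rw [← mul_assoc, mul_inv_cancel₀ (by simp [Real.pi_ne_zero]), one_mul]

theorem IsHolomorphicSelfMapOfDisc.lintegral_circle_sub_le {f : ℂ → ℂ}
    (hf : IsHolomorphicSelfMapOfDisc f) {r : ℝ} (hr : r ∈ Set.Ioo 0 1) :
    ∫⁻ θ in Set.Ioc (-Real.pi) Real.pi, ‖f (r * Circle.exp θ) - f 0‖ₑ ^ 2 ≤
      ENNReal.ofReal (4 * Real.pi * (1 - ‖f 0‖)) := by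
  have hle : -Real.pi ≤ Real.pi := by linarith [Real.pi_pos]
  have hcont := hf.continuous_circle hr
  have h0 : ‖f 0‖ < 1 := by simpa using hf.2 (Metric.mem_ball_self one_pos)
  -- This is the expansion of `|f - f 0|²` with `|f|²` replaced by 1.
  set u : ℝ → ℝ := fun θ => 1 + ‖f 0‖ ^ 2 - 2 * (starRingEnd ℂ (f 0) * f (r * Circle.exp θ)).re
  have hre : Continuous fun θ : ℝ => (starRingEnd ℂ (f 0) * f (r * Circle.exp θ)).re :=
    Complex.continuous_re.comp (hcont.const_mul _)
  have hu : Continuous u := continuous_const.sub (hre.const_mul 2)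
  have hint : ∫ θ in -Real.pi..Real.pi, u θ = 2 * Real.pi * (1 - ‖f 0‖ ^ 2) := by
    have h1 : ∫ θ in -Real.pi..Real.pi, (starRingEnd ℂ (f 0) * f (r * Circle.exp θ)).re =
        2 * Real.pi * ‖f 0‖ ^ 2 := by
      have h2 := Complex.reCLM.intervalIntegral_comp_comm (μ := volume)
        ((hcont.const_mul (starRingEnd ℂ (f 0))).intervalIntegrable (-Real.pi) Real.pi)
      simp only [Complex.reCLM_apply] at h2
      rw [h2, intervalIntegral.integral_const_mul, hf.integral_circle hr, mul_left_comm,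
        mul_comm (starRingEnd ℂ _), Complex.mul_conj, Complex.normSq_eq_norm_sq]
      norm_cast
    rw [intervalIntegral.integral_sub (by simp)
      ((hre.const_mul 2).intervalIntegrable _ _), intervalIntegral.integral_const_mul, h1]
    simp
    ring
  calc _ ≤ ∫⁻ θ in Set.Ioc (-Real.pi) Real.pi, ENNReal.ofReal (u θ) := by
        refine lintegral_mono fun θ => ?_
        rw [← ofReal_norm, ← ENNReal.ofReal_pow (norm_nonneg _)]
        apply ENNReal.ofReal_le_ofReal
        have h1 : ‖f (r * Circle.exp θ)‖ < 1 := by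
          exact mem_ball_zero_iff.1 (hf.2 (ofReal_mul_circle_mem_ball hr _))
        have h2 : ‖f (r * Circle.exp θ) - f 0‖ ^ 2 = ‖f (r * Circle.exp θ)‖ ^ 2 + ‖f 0‖ ^ 2
            - 2 * (starRingEnd ℂ (f 0) * f (r * Circle.exp θ)).re := by
          rw [← Complex.normSq_eq_norm_sq, Complex.normSq_sub, Complex.normSq_eq_norm_sq,
            Complex.normSq_eq_norm_sq, mul_comm (starRingEnd ℂ _)]
        rw [h2]
        simp only [u]
        nlinarith [norm_nonneg (f (r * Circle.exp θ))]
    _ = ENNReal.ofReal (2 * Real.pi * (1 - ‖f 0‖ ^ 2)) := by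
        rw [← hint, intervalIntegral.integral_of_le hle]
        refine (ofReal_integral_eq_lintegral_ofReal ?_ (Eventually.of_forall fun θ => ?_)).symm
        · exact (intervalIntegrable_iff_integrableOn_Ioc_of_le hle).1 (hu.intervalIntegrable _ _)
        · have h1 : ‖f (r * Circle.exp θ)‖ < 1 := by
            exact mem_ball_zero_iff.1 (hf.2 (ofReal_mul_circle_mem_ball hr _))
          have h2 := Complex.re_le_norm (starRingEnd ℂ (f 0) * f (r * Circle.exp θ))
          rw [norm_mul, Complex.norm_conj] at h2
          simp only [u, Pi.zero_apply]
          nlinarith [norm_nonneg (f 0), sq_nonneg (1 - ‖f 0‖)]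
    _ ≤ _ := by
        apply ENNReal.ofReal_le_ofReal
        nlinarith [norm_nonneg (f 0), Real.pi_pos,
          mul_nonneg Real.pi_pos.le (sq_nonneg (1 - ‖f 0‖))]

/-! ### Passage to the boundary and summation -/

/-- A property that holds at `e^{iθ}` for almost every `θ` holds almost everywhere on the circle;
no measurability is assumed. -/
theorem ae_arcLength_of_ae {p : Circle → Prop}
    (hp : ∀ᵐ θ ∂volume.restrict (Set.Ioc (-Real.pi) Real.pi), p (Circle.exp θ)) :
    ∀ᵐ ζ ∂arcLength, p ζ := by
  obtain ⟨N, hsub, hN, hN0⟩ := exists_measurable_superset_of_null (ae_iff.1 hp)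
  have harg : Measurable fun ζ : Circle => Complex.arg ζ :=
    Complex.measurable_arg.comp
      (show Continuous fun ζ : Circle => (ζ : ℂ) by fun_prop).measurable
  have hB : MeasurableSet {ζ : Circle | Complex.arg ζ ∈ N} := harg hN
  refine ae_iff.2 (measure_mono_null (t := {ζ : Circle | Complex.arg ζ ∈ N}) ?_ ?_)
  · intro ζ hζ
    apply hsub
    simpa [Circle.exp_arg] using hζ
  · rw [arcLength, Measure.map_apply Circle.exp.continuous.measurable hB,
      Measure.restrict_apply (Circle.exp.continuous.measurable hB)]
    rw [Measure.restrict_apply hN] at hN0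
    refine measure_mono_null ?_ hN0
    rintro θ ⟨h1, h2⟩
    have h3 : Complex.arg (Circle.exp θ) ∈ N := h1
    rw [Circle.arg_exp h2.1 h2.2] at h3
    exact ⟨h3, h2⟩

theorem ae_exists_tendsto_dist {F : ℕ → ℂ → ℂ} (hF : ∀ n, IsHolomorphicSelfMapOfDisc (F n))
    (hsum : Summable fun n => 1 - ‖F n 0‖) :
    ∀ᵐ θ ∂volume.restrict (Set.Ioc (-Real.pi) Real.pi), ∃ w : ℕ → ℂ,
      (∀ n, HasRadialLimit (F n) (Circle.exp θ) (w n)) ∧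
      Tendsto (fun n => dist (w n) (F n 0)) atTop (𝓝 0) := by
  obtain ⟨r, -, hr, hrlim⟩ := exists_seq_strictMono_tendsto' (zero_lt_one (α := ℝ))
  have hrlim' : Tendsto r atTop (𝓝[<] 1) :=
    tendsto_nhdsWithin_iff.2 ⟨hrlim, Eventually.of_forall fun k => (hr k).2⟩
  -- A liminf along a sequence of radii is measurable in `θ` without choosing a boundary function,
  -- and equals `|w n - F n 0|²` wherever the radial limit exists.
  set H : ℕ → ℝ → ENNReal := fun n θ =>
    liminf (fun k => ‖F n (r k * Circle.exp θ) - F n 0‖ₑ ^ 2) atTop with hH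
  have hmeas : ∀ n k, Measurable fun θ : ℝ => ‖F n (r k * Circle.exp θ) - F n 0‖ₑ ^ 2 :=
    fun n k => ((((hF n).continuous_circle (hr k)).sub continuous_const).measurable.enorm).pow_const 2
  have hHm : ∀ n, Measurable (H n) := fun n => Measurable.liminf (hmeas n)
  have hHle : ∀ n, ∫⁻ θ in Set.Ioc (-Real.pi) Real.pi, H n θ ≤
      ENNReal.ofReal (4 * Real.pi * (1 - ‖F n 0‖)) := fun n =>
    (lintegral_liminf_le (hmeas n)).trans <| liminf_le_of_le (by isBoundedDefault)
      fun b hb => by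
        obtain ⟨k, hk⟩ := hb.exists
        exact hk.trans ((hF n).lintegral_circle_sub_le (hr k))
  have hfin : ∫⁻ θ in Set.Ioc (-Real.pi) Real.pi, ∑' n, H n θ ≠ ⊤ := by
    rw [lintegral_tsum fun n => (hHm n).aemeasurable]
    exact ne_top_of_le_ne_top (hsum.mul_left (4 * Real.pi)).tsum_ofReal_ne_top
      (ENNReal.tsum_le_tsum hHle)
  have hlim := ae_restrict_of_ae (s := Set.Ioc (-Real.pi) Real.pi)
    (ae_all_iff.2 fun n => (hF n).ae_exists_hasRadialLimit)
  filter_upwards [hlim, ae_lt_top (Measurable.tsum hHm) hfin] with θ h1 h2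
  choose w hw using h1
  refine ⟨w, hw, ?_⟩
  have h3 : ∀ n, H n θ = ‖w n - F n 0‖ₑ ^ 2 := fun n =>
    ((ENNReal.continuous_pow 2).tendsto _ |>.comp
      (((hw n).comp hrlim').sub_const (F n 0)).enorm).liminf_eq
  have h4 := ENNReal.tendsto_atTop_zero_of_tsum_ne_top h2.ne
  simp only [h3] at h4
  have h5 := (ENNReal.tendsto_toReal ENNReal.zero_ne_top).comp h4
  have h6 := h5.sqrt
  simpa [Function.comp_def, dist_eq_norm, Real.sqrt_sq] using h6

theorem theoremE (F : ℕ → ℂ → ℂ) (hF : ∀ n, IsHolomorphicSelfMapOfDisc (F n))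
    (hsum : Summable fun n => 1 - ‖F n 0‖) :
    (∀ᵐ ζ ∂arcLength, ∃ w : ℕ → ℂ, (∀ n, HasRadialLimit (F n) ζ (w n)) ∧
      Tendsto (fun n => dist (w n) (F n 0)) atTop (𝓝 0)) ∧
    arcLength (denjoyWolffSet F) = arcLength Set.univ := by
  have h := ae_arcLength_of_ae (p := fun ζ => ∃ w : ℕ → ℂ, (∀ n, HasRadialLimit (F n) ζ (w n)) ∧
    Tendsto (fun n => dist (w n) (F n 0)) atTop (𝓝 0)) (ae_exists_tendsto_dist hF hsum)
  exact ⟨h, measure_congr (eventuallyEq_univ.2 h)⟩
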